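/- Let $R$ be a commutative ring and let $\mathcal P=(\mathcal P(n))_{n\in\mathbb N}$ be a symmetric operad in $R$-modules. Let $\mathsf{ALG}_{\mathcal P}$ be the category of $\mathcal P$-algebras, i.e. $R$-modules $A$ with operations $\mu(a_1,\dots,a_n)\in A$ for $\mu\in\mathcal P(n)$, $R$-linear in $\mu$ and in each $a_i\in A$ and compatible with the unit, the compositions and the symmetric group actions of $\mathcal P$. Equip it with the Cartesian (Rosický) tangent structure $\mathbb T=(\mathsf T,p,s,z,l,c,n)$ whose tangent bundle functor sends $A$ to the semi-direct product $\mathsf T(A)=A\ltimes A$, which is the $R$-module $A\times A$ with the operations $$\mu\big((a_1,b_1),\dots,(a_n,b_n)\big)=\Big(\mu(a_1,\dots,a_n),\ \sum_{i=1}^n\mu(a_1,\dots,a_{i-1},b_i,a_{i+1},\dots,a_n)\Big),$$ and a morphism $f$ to $f\times f$. The $k$-fold pullback $\mathsf T_k(A)$ of the projection is the module $A\times A^k$ with the analogous operations and projections $q_j(a,b_1,\dots,b_k)=(a,b_j)$, and the structure maps are $p(a,b)=a$, $s(a,b_1,b_2)=(a,b_1+b_2)$, $z(a)=(a,0)$,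 $l(a,b)=(a,0,0,b)$, $c(a,b,c,d)=(a,c,b,d)$, $n(a,b)=(a,-b)$. A differential object structure on an object $A$ of a Cartesian tangent category, with terminal object $\ast$ and $t_X\colon X\to\ast$, consists of maps $\hat p\colon\mathsf T(A)\to A$, $\sigma\colon A\times A\to A$ and $\zeta\colon\ast\to A$ such that $(A,\sigma,\zeta)$ is a commutative monoid, $\langle p,\hat p\rangle\colon\mathsf T(A)\to A\times A$ is an isomorphism, and $$\hat p\circ s=\sigma\circ\langle\hat p\circ q_1,\hat p\circ q_2\rangle,\qquad \hat p\circ z=\zeta\circ t_A,\qquad \hat p\circ\mathsf T(\sigma)=\sigma\circ\langle\hat p\circ\mathsf T(\pi_1),\hat p\circ\mathsf T(\pi_2)\rangle,$$ $$\hat p\circ\mathsf T(\zeta)=\zeta\circ t_{\mathsf T(\ast)},\qquad \hat p\circ\mathsf T(\hat p)\circ l=\hat p .$$ Then, for every $\mathcal P$-algebra $A$, there is at most one differential object structure on $A$ in $(\mathsf{ALG}_{\mathcal P},\mathbb T)$, and there is one if and only if $\mu(a_1,\dots,a_n)=0$ for all $n\in\mathbb N$ with $n\neq1$, all $\mu\in\mathcal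 P(n)$ and all $a_1,\dots,a_n\in A$. -/

import Mathlib

namespace OperadTangent

open CategoryTheory CategoryTheory.MonoidalCategory CategoryTheory.CartesianMonoidalCategory

universe u v w v₁ u₁

attribute [-instance] catToReflQuiver

noncomputable section

/-! ### Tangent categories -/

section Tangent

variable {C : Type u₁} [Category.{v₁} C]

/-- `E`, with maps `q j : E ⟶ B` and `π : E ⟶ A`, is the `n`-fold pullback of `p : B ⟶ A`. For
`n = 0` this says that `π` is an isomorphism. -/
def IsNFoldPullback {A B E : C} {n : ℕ} (p : B ⟶ A) (π : E ⟶ A) (q : Fin n → (E ⟶ B)) : Prop :=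
  (∀ j, q j ≫ p = π) ∧
    ∀ (X : C) (x : X ⟶ A) (g : Fin n → (X ⟶ B)), (∀ j, g j ≫ p = x) →
      ∃! e : X ⟶ E, e ≫ π = x ∧ ∀ j, e ≫ q j = g j

/-- The `m`-th iterate of an endofunctor. -/
def iter (T : C ⥤ C) : ℕ → (C ⥤ C)
  | 0 => 𝟭 C
  | m + 1 => iter T m ⋙ T

variable (C)

/-- A tangent structure on a category. Compositions are written in diagrammatic order. A pairing
into a pullback power `Tₙ A` is quantified as the (unique, by `isPullback`) map with the prescribed
components. -/
structure TangentStructure where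
  /-- the tangent bundle functor -/
  T : C ⥤ C
  /-- the projection -/
  p : T ⟶ 𝟭 C
  /-- the functor of `n`-fold pullbacks of the projection -/
  Tn : ℕ → (C ⥤ C)
  /-- the structure map of the `n`-fold pullback to the base -/
  π : ∀ n, Tn n ⟶ 𝟭 C
  /-- the projections of the `n`-fold pullback -/
  q : ∀ n, Fin n → (Tn n ⟶ T)
  /-- `Tn n` is the `n`-fold pullback of `p`, and all iterates of `T` preserve it -/
  isPullback : ∀ (m n : ℕ) (A : C), IsNFoldPullback ((iter T m).map (p.app A))
    ((iter T m).map ((π n).app A)) (fun j => (iter T m).map ((q n j).app A))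
  /-- the sum -/
  s : Tn 2 ⟶ T
  /-- the zero map -/
  z : 𝟭 C ⟶ T
  /-- the vertical lift -/
  l : T ⟶ T ⋙ T
  /-- the canonical flip -/
  c : T ⋙ T ⟶ T ⋙ T
  /- `(p, s, z)` is a commutative monoid over the base -/
  s_p : ∀ A, s.app A ≫ p.app A = (π 2).app A
  z_p : ∀ A, z.app A ≫ p.app A = 𝟙 A
  s_zero : ∀ (A : C) (e : T.obj A ⟶ (Tn 2).obj A), e ≫ (q 2 0).app A = 𝟙 (T.obj A) →
    e ≫ (q 2 1).app A = p.app A ≫ z.app A → e ≫ s.app A = 𝟙 (T.obj A)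
  s_comm : ∀ (A : C) (e : (Tn 2).obj A ⟶ (Tn 2).obj A), e ≫ (q 2 0).app A = (q 2 1).app A →
    e ≫ (q 2 1).app A = (q 2 0).app A → e ≫ s.app A = s.app A
  s_assoc : ∀ (A : C) (e₁₂ e₂₃ e e' : (Tn 3).obj A ⟶ (Tn 2).obj A),
    e₁₂ ≫ (q 2 0).app A = (q 3 0).app A → e₁₂ ≫ (q 2 1).app A = (q 3 1).app A →
    e₂₃ ≫ (q 2 0).app A = (q 3 1).app A → e₂₃ ≫ (q 2 1).app A = (q 3 2).app A →
    e ≫ (q 2 0).app A = e₁₂ ≫ s.app A → e ≫ (q 2 1).app A = (q 3 2).app A →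
    e' ≫ (q 2 0).app A = (q 3 0).app A → e' ≫ (q 2 1).app A = e₂₃ ≫ s.app A →
    e ≫ s.app A = e' ≫ s.app A
  /- `(l, z)` is an additive bundle morphism from `(p, s, z)` to `(T p, T s, T z)` -/
  l_p : ∀ A, l.app A ≫ T.map (p.app A) = p.app A ≫ z.app A
  l_z : ∀ A, z.app A ≫ l.app A = z.app A ≫ T.map (z.app A)
  l_s : ∀ (A : C) (e : (Tn 2).obj A ⟶ T.obj ((Tn 2).obj A)),
    e ≫ T.map ((q 2 0).app A) = (q 2 0).app A ≫ l.app A →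
    e ≫ T.map ((q 2 1).app A) = (q 2 1).app A ≫ l.app A →
    s.app A ≫ l.app A = e ≫ T.map (s.app A)
  /- `(c, 1)` is an additive bundle morphism from `(T p, T s, T z)` to `(p T, s T, z T)` -/
  c_p : ∀ A, c.app A ≫ p.app (T.obj A) = T.map (p.app A)
  c_z : ∀ A, T.map (z.app A) ≫ c.app A = z.app (T.obj A)
  c_s : ∀ (A : C) (e : T.obj ((Tn 2).obj A) ⟶ (Tn 2).obj (T.obj A)),
    e ≫ (q 2 0).app (T.obj A) = T.map ((q 2 0).app A) ≫ c.app A →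
    e ≫ (q 2 1).app (T.obj A) = T.map ((q 2 1).app A) ≫ c.app A →
    T.map (s.app A) ≫ c.app A = e ≫ s.app (T.obj A)
  /- coherences between `l` and `c` -/
  c_c : ∀ A, c.app A ≫ c.app A = 𝟙 (T.obj (T.obj A))
  l_c : ∀ A, l.app A ≫ c.app A = l.app A
  l_l : ∀ A, l.app A ≫ T.map (l.app A) = l.app A ≫ l.app (T.obj A)
  c_braid : ∀ A, T.map (c.app A) ≫ c.app (T.obj A) ≫ T.map (c.app A) =
    c.app (T.obj A) ≫ T.map (c.app A) ≫ c.app (T.obj A)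
  l_c_c : ∀ A, l.app (T.obj A) ≫ T.map (c.app A) ≫ c.app (T.obj A) = c.app A ≫ T.map (l.app A)
  /-- universality of the vertical lift, preserved by all iterates of `T` -/
  universal : ∀ (m : ℕ) (A : C) (e : (Tn 2).obj A ⟶ T.obj ((Tn 2).obj A)),
    e ≫ T.map ((q 2 0).app A) = (q 2 0).app A ≫ l.app A →
    e ≫ T.map ((q 2 1).app A) = (q 2 1).app A ≫ z.app (T.obj A) →
    IsPullback ((iter T m).map (e ≫ T.map (s.app A))) ((iter T m).map ((π 2).app A))
      ((iter T m).map (T.map (p.app A))) ((iter T m).map (z.app A))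

/-- A Cartesian tangent structure on a category with (chosen) finite products: the tangent bundle
functor preserves binary products and the terminal object, hence all finite products. -/
structure CartesianTangentStructure [CartesianMonoidalCategory C] extends TangentStructure C where
  isIso_prod : ∀ A B : C, IsIso (lift (T.map (fst A B)) (T.map (snd A B)))
  isIso_terminal : IsIso (toUnit (T.obj (𝟙_ C)))

/-- A Cartesian Rosický tangent structure: a Cartesian tangent structure with negatives. -/
structure CartesianRosickyTangentStructure [CartesianMonoidalCategory C] extends
    CartesianTangentStructure C where
  /-- the negative map -/
  neg : T ⟶ T
  neg_p : ∀ A, neg.app A ≫ p.app A = p.app A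
  neg_s : ∀ (A : C) (e : T.obj A ⟶ (Tn 2).obj A), e ≫ (q 2 0).app A = 𝟙 (T.obj A) →
    e ≫ (q 2 1).app A = neg.app A → e ≫ s.app A = p.app A ≫ z.app A

variable {C}

/-- The structure of a differential object on an object `A` of a Cartesian tangent category. -/
structure DifferentialStructure [CartesianMonoidalCategory C] (𝕋 : CartesianTangentStructure C)
    (A : C) where
  /-- the differential projection -/
  phat : 𝕋.T.obj A ⟶ A
  /-- the sum -/
  σ : A ⊗ A ⟶ A
  /-- the zero -/
  ζ : 𝟙_ C ⟶ A
  /- `(A, σ, ζ)` is a commutative monoid -/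
  zero_add : lift (toUnit A ≫ ζ) (𝟙 A) ≫ σ = 𝟙 A
  add_zero : lift (𝟙 A) (toUnit A ≫ ζ) ≫ σ = 𝟙 A
  add_comm : lift (snd A A) (fst A A) ≫ σ = σ
  add_assoc : σ ▷ A ≫ σ = (α_ A A A).hom ≫ A ◁ σ ≫ σ
  /-- `A ⟵ T A ⟶ A` is a product diagram -/
  isIso_lift : IsIso (lift (𝕋.p.app A) phat)
  /- compatibility with the additive structure of the tangent bundle -/
  phat_s : 𝕋.s.app A ≫ phat = lift ((𝕋.q 2 0).app A ≫ phat) ((𝕋.q 2 1).app A ≫ phat) ≫ σ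
  phat_z : 𝕋.z.app A ≫ phat = toUnit A ≫ ζ
  /- the sum and the zero are compatible with the differential projection -/
  phat_sum : 𝕋.T.map σ ≫ phat = lift (𝕋.T.map (fst A A) ≫ phat) (𝕋.T.map (snd A A) ≫ phat) ≫ σ
  phat_zero : 𝕋.T.map ζ ≫ phat = toUnit (𝕋.T.obj (𝟙_ C)) ≫ ζ
  /-- compatibility with the vertical lift -/
  phat_lift : 𝕋.l.app A ≫ 𝕋.T.map phat ≫ phat = phat

end Tangent

/-! ### Operads and their algebras -/

/-- The position, among the `k = m + n - 1` inputs of `μ ∘ᵢ ν`, of the input `t` of `ν`. -/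
def inner {m n k : ℕ} (h : k + 1 = m + n) (i : Fin m) (t : Fin n) : Fin k :=
  ⟨i + t, by omega⟩

/-- The position, among the `k = m + n - 1` inputs of `μ ∘ᵢ ν`, of the input `j ≠ i` of `μ`. -/
def outer {m n k : ℕ} (h : k + 1 = m + n) (i j : Fin m) (hj : j ≠ i) : Fin k :=
  if hlt : j < i then ⟨j, by omega⟩ else ⟨j + n - 1, by omega⟩

/-- A symmetric operad in `R`-modules, in terms of partial compositions. -/
structure Operad (R : Type u) [CommRing R] where
  /-- the module of operations of arity `n` -/
  obj : ℕ → Type v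
  [addCommGroup : ∀ n, AddCommGroup (obj n)]
  [module : ∀ n, Module R (obj n)]
  /-- the distinguished element -/
  one : obj 1
  /-- the right action `μ · σ` of the symmetric groups -/
  perm : ∀ {n : ℕ}, Equiv.Perm (Fin n) → (obj n →ₗ[R] obj n)
  perm_one : ∀ {n : ℕ} (μ : obj n), perm 1 μ = μ
  perm_mul : ∀ {n : ℕ} (σ τ : Equiv.Perm (Fin n)) (μ : obj n), perm (σ * τ) μ = perm τ (perm σ μ)
  /-- the partial compositions `μ ∘ᵢ ν`, of arity `k = m + n - 1` -/
  circ : ∀ {m n k : ℕ} (_ : k + 1 = m + n) (_ : Fin m), obj m →ₗ[R] obj n →ₗ[R] obj k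
  one_circ : ∀ {n : ℕ} (h : n + 1 = 1 + n) (i : Fin 1) (ν : obj n), circ h i one ν = ν
  circ_one : ∀ {m : ℕ} (h : m + 1 = m + 1) (i : Fin m) (μ : obj m), circ h i μ one = μ
  /-- sequential composition: `(κ ∘ᵢ μ) ∘ᵢ₋₁₊ⱼ ν = κ ∘ᵢ (μ ∘ⱼ ν)` -/
  circ_seq : ∀ {d m n a b k : ℕ} (ha : a + 1 = d + m) (hb : b + 1 = m + n)
    (hk : k + 1 = a + n) (hk' : k + 1 = d + b) (i : Fin d) (j : Fin m)
    (κ : obj d) (μ : obj m) (ν : obj n),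
    circ hk (inner ha i j) (circ ha i κ μ) ν = circ hk' i κ (circ hb j μ ν)
  /-- parallel composition: `(κ ∘ᵢ μ) ∘ⱼ' ν = (κ ∘ⱼ ν) ∘ᵢ' μ` for two different inputs of `κ` -/
  circ_par : ∀ {d m n a b k : ℕ} (ha : a + 1 = d + m) (hb : b + 1 = d + n)
    (hk : k + 1 = a + n) (hk' : k + 1 = b + m) (i j : Fin d) (hij : i ≠ j)
    (κ : obj d) (μ : obj m) (ν : obj n),
    circ hk (outer ha i j hij.symm) (circ ha i κ μ) ν =
      circ hk' (outer hb j i hij) (circ hb j κ ν) μ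
  /-- equivariance in the inner operation; `τ` is `σ` on the inputs of the inner operation and the
  identity elsewhere -/
  circ_perm : ∀ {m n k : ℕ} (h : k + 1 = m + n) (i : Fin m) (μ : obj m) (ν : obj n)
    (σ : Equiv.Perm (Fin n)) (τ : Equiv.Perm (Fin k)),
    (∀ t, τ (inner h i t) = inner h i (σ t)) → (∀ j hj, τ (outer h i j hj) = outer h i j hj) →
    circ h i μ (perm σ ν) = perm τ (circ h i μ ν)
  /-- equivariance in the outer operation; `τ` is the block permutation induced by `σ` -/
  perm_circ : ∀ {m n k : ℕ} (h : k + 1 = m + n) (i : Fin m) (μ : obj m) (ν : obj n)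
    (σ : Equiv.Perm (Fin m)) (τ : Equiv.Perm (Fin k)),
    (∀ t, τ (inner h i t) = inner h (σ i) t) →
    (∀ j hj, τ (outer h i j hj) = outer h (σ i) (σ j) (fun e => hj (σ.injective e))) →
    circ h i (perm σ μ) ν = perm τ (circ h (σ i) μ ν)

attribute [instance] Operad.addCommGroup Operad.module

variable {R : Type u} [CommRing R]

/-- The inputs of `f` in `f ∘ᵢ g`, when the inputs of `f ∘ᵢ g` are `x`. -/
def plug {A : Type w} {m n k : ℕ} (h : k + 1 = m + n) (i : Fin m) (g : (Fin n → A) → A)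
    (x : Fin k → A) (j : Fin m) : A :=
  if hj : j = i then g (fun t => x (inner h i t)) else x (outer h i j hj)

/-- An algebra over the operad `P`: an `R`-module `A` with multilinear operations
`μ(a₁, …, aₙ)`, depending linearly on `μ ∈ P(n)`, that are compatible with the unit, the symmetric
group actions and the partial compositions of `P`. -/
structure Alg (P : Operad.{u, v} R) where
  /-- the underlying module -/
  carrier : Type w
  [addCommGroup : AddCommGroup carrier]
  [module : Module R carrier]
  /-- the operations -/
  act : ∀ n : ℕ, P.obj n →ₗ[R] MultilinearMap R (fun _ : Fin n => carrier) carrier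
  act_one : ∀ a : Fin 1 → carrier, act 1 P.one a = a 0
  act_perm : ∀ {n : ℕ} (σ : Equiv.Perm (Fin n)) (μ : P.obj n) (a : Fin n → carrier),
    act n (P.perm σ μ) a = act n μ (a ∘ σ.symm)
  act_circ : ∀ {m n k : ℕ} (h : k + 1 = m + n) (i : Fin m) (μ : P.obj m) (ν : P.obj n)
    (a : Fin k → carrier), act k (P.circ h i μ ν) a = act m μ (plug h i (act n ν) a)

attribute [instance] Alg.addCommGroup Alg.module

variable {P : Operad.{u, v} R}

/-- A morphism of `P`-algebras. -/
@[ext]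
structure AlgHom (A B : Alg.{u, v, w} P) where
  /-- the underlying linear map -/
  toLin : A.carrier →ₗ[R] B.carrier
  map_act : ∀ (n : ℕ) (μ : P.obj n) (a : Fin n → A.carrier),
    toLin (A.act n μ a) = B.act n μ (fun i => toLin (a i))

/-- The category of `P`-algebras. -/
instance : Category (Alg.{u, v, w} P) where
  Hom A B := AlgHom A B
  id A := ⟨LinearMap.id, fun _ _ _ => rfl⟩
  comp f g := ⟨g.toLin ∘ₗ f.toLin, fun n μ a => by simp [f.map_act, g.map_act]⟩

@[simp]
lemma id_toLin (A : Alg.{u, v, w} P) (a : A.carrier) : AlgHom.toLin (𝟙 A) a = a := rfl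

@[simp]
lemma comp_toLin {A B D : Alg.{u, v, w} P} (f : A ⟶ B) (g : B ⟶ D) (a : A.carrier) :
    AlgHom.toLin (f ≫ g) a = AlgHom.toLin g (AlgHom.toLin f a) := rfl

lemma hom_ext' {A B : Alg.{u, v, w} P} {f g : A ⟶ B}
    (h : ∀ a, AlgHom.toLin f a = AlgHom.toLin g a) : f = g :=
  AlgHom.ext (LinearMap.ext h)

/-! ### Finite products of algebras -/

/-- The zero algebra. -/
abbrev zeroAlg (P : Operad.{u, v} R) : Alg.{u, v, w} P where
  carrier := PUnit
  act _ := 0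
  act_one _ := rfl
  act_perm _ _ _ := rfl
  act_circ _ _ _ _ _ := rfl

/-- The product of two algebras, with componentwise operations. -/
abbrev prodAlg (A B : Alg.{u, v, w} P) : Alg.{u, v, w} P where
  carrier := A.carrier × B.carrier
  act n :=
    { toFun := fun μ => ((A.act n μ).compLinearMap fun _ => LinearMap.fst R _ _).prod
        ((B.act n μ).compLinearMap fun _ => LinearMap.snd R _ _)
      map_add' := fun μ ν => by ext <;> simp
      map_smul' := fun r μ => by ext <;> simp }
  act_one a := by simp [A.act_one, B.act_one]
  act_perm σ μ a := by simp [A.act_perm, B.act_perm, Function.comp_def]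
  act_circ h i μ ν a := by
    simp only [LinearMap.coe_mk, AddHom.coe_mk, MultilinearMap.prod_apply,
      MultilinearMap.compLinearMap_apply, A.act_circ, B.act_circ]
    congr 2 <;> funext j <;> by_cases hj : j = i <;> simp [plug, hj]

/-- The zero algebra is terminal. -/
def isTerminalZeroAlg (P : Operad.{u, v} R) : Limits.IsTerminal (zeroAlg.{u, v, w} P) :=
  Limits.IsTerminal.ofUniqueHom (fun _ => ⟨0, fun _ _ _ => rfl⟩) (fun _ _ => hom_ext' fun _ => rfl)

/-- The first projection of a product. -/
def fstHom (A B : Alg.{u, v, w} P) : prodAlg A B ⟶ A := ⟨LinearMap.fst R _ _, fun _ _ _ => rfl⟩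

/-- The second projection of a product. -/
def sndHom (A B : Alg.{u, v, w} P) : prodAlg A B ⟶ B := ⟨LinearMap.snd R _ _, fun _ _ _ => rfl⟩

/-- The pairing of two morphisms. -/
def pairHom {X A B : Alg.{u, v, w} P} (f : X ⟶ A) (g : X ⟶ B) : X ⟶ prodAlg A B :=
  ⟨LinearMap.prod (AlgHom.toLin f) (AlgHom.toLin g),
    fun n μ a => Prod.ext (AlgHom.map_act f n μ a) (AlgHom.map_act g n μ a)⟩

/-- `prodAlg A B` is the categorical product of `A` and `B`. -/
def isLimitProdAlg (A B : Alg.{u, v, w} P) :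
    Limits.IsLimit (Limits.BinaryFan.mk (fstHom A B) (sndHom A B)) :=
  Limits.BinaryFan.isLimitMk (fun c => pairHom c.fst c.snd) (fun _ => rfl) (fun _ => rfl)
    (fun c m h₁ h₂ => hom_ext' fun a => Prod.ext
      (by rw [← h₁]; rfl) (by rw [← h₂]; rfl))

/-- The category of `P`-algebras with its finite products. -/
instance : CartesianMonoidalCategory (Alg.{u, v, w} P) :=
  .ofChosenFiniteProducts ⟨_, isTerminalZeroAlg P⟩
    (fun A B => ⟨_, isLimitProdAlg A B⟩)

/-! ### The semi-direct products `A ⋉ Aⁿ` -/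

/-- The multilinear map `((a₁, b₁), …, (aₙ, bₙ)) ↦ ∑ᵢ f(a₁, …, bᵢ, …, aₙ)`. -/
def deriv {A : Type w} [AddCommGroup A] [Module R A] {n : ℕ}
    (f : MultilinearMap R (fun _ : Fin n => A) A) :
    MultilinearMap R (fun _ : Fin n => A × A) A :=
  ∑ i, f.compLinearMap fun j => if j = i then LinearMap.snd R A A else LinearMap.fst R A A

lemma deriv_apply {A : Type w} [AddCommGroup A] [Module R A] {n : ℕ}
    (f : MultilinearMap R (fun _ : Fin n => A) A) (x : Fin n → A × A) :
    deriv f x = ∑ i, f fun j => if j = i then (x j).2 else (x j).1 := by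
  simp only [deriv, sum_apply, MultilinearMap.compLinearMap_apply]
  refine Finset.sum_congr rfl fun i _ => ?_
  congr 1
  funext j
  split_ifs <;> rfl

lemma deriv_add {A : Type w} [AddCommGroup A] [Module R A] {n : ℕ}
    (f g : MultilinearMap R (fun _ : Fin n => A) A) : deriv (f + g) = deriv f + deriv g := by
  ext x; simp [deriv_apply, Finset.sum_add_distrib]

lemma deriv_smul {A : Type w} [AddCommGroup A] [Module R A] {n : ℕ} (r : R)
    (f : MultilinearMap R (fun _ : Fin n => A) A) : deriv (r • f) = r • deriv f := by
  ext x; simp [deriv_apply, Finset.smul_sum]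

lemma outer_val {m n k : ℕ} (h : k + 1 = m + n) (i j : Fin m) (hj : j ≠ i) :
    (outer h i j hj : ℕ) = if (j : ℕ) < i then (j : ℕ) else j + n - 1 := by
  unfold outer
  by_cases hlt : j < i
  · rw [dif_pos hlt, if_pos (Fin.lt_def.1 hlt)]
  · rw [dif_neg hlt, if_neg (fun e => hlt (Fin.lt_def.2 e))]

lemma inner_ne_outer {m n k : ℕ} (h : k + 1 = m + n) (i : Fin m) (t : Fin n) (j : Fin m)
    (hj : j ≠ i) : inner h i t ≠ outer h i j hj := by
  rw [Ne, Fin.ext_iff, outer_val]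
  have := Fin.val_ne_of_ne hj
  simp only [inner]
  split_ifs <;> omega

lemma inner_inj {m n k : ℕ} (h : k + 1 = m + n) (i : Fin m) (t t' : Fin n) :
    inner h i t = inner h i t' ↔ t = t' := by
  simp [inner, Fin.ext_iff]

lemma outer_inj {m n k : ℕ} (h : k + 1 = m + n) (i j j' : Fin m) (hj : j ≠ i) (hj' : j' ≠ i) :
    outer h i j hj = outer h i j' hj' ↔ j = j' := by
  rw [Fin.ext_iff, Fin.ext_iff, outer_val, outer_val]
  have := Fin.val_ne_of_ne hj
  have := Fin.val_ne_of_ne hj'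
  split_ifs <;> omega

lemma inputs_cases {m n k : ℕ} (h : k + 1 = m + n) (i : Fin m) (r : Fin k) :
    (∃ t, inner h i t = r) ∨ ∃ j hj, outer h i j hj = r := by
  by_cases h₁ : (r : ℕ) < i
  · right
    refine ⟨⟨r, by omega⟩, fun e => ?_, ?_⟩
    · rw [Fin.ext_iff] at e
      exact absurd e (by simp only; omega)
    · rw [Fin.ext_iff, outer_val, if_pos h₁]
  · by_cases h₂ : (r : ℕ) < i + n
    · left
      exact ⟨⟨r - i, by omega⟩, by rw [Fin.ext_iff]; simp only [inner]; omega⟩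
    · right
      refine ⟨⟨r + 1 - n, by omega⟩, fun e => ?_, ?_⟩
      · rw [Fin.ext_iff] at e
        exact absurd e (by simp only; omega)
      · rw [Fin.ext_iff, outer_val, if_neg (by simp only; omega)]
        simp only
        omega

lemma sum_inputs {M : Type w} [AddCommMonoid M] {m n k : ℕ} (h : k + 1 = m + n) (i : Fin m)
    (F : Fin k → M) :
    ∑ r, F r = ∑ t, F (inner h i t) + ∑ j : {j : Fin m // j ≠ i}, F (outer h i j.1 j.2) := by
  have hb : Function.Bijective
      (Sum.elim (inner h i) (fun j : {j : Fin m // j ≠ i} => outer h i j.1 j.2)) := by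
    constructor
    · rintro (t | ⟨j, hj⟩) (t' | ⟨j', hj'⟩) e
      · exact congrArg _ ((inner_inj h i t t').1 e)
      · exact absurd e (inner_ne_outer h i t j' hj')
      · exact absurd e.symm (inner_ne_outer h i t' j hj)
      · exact congrArg _ (Subtype.ext ((outer_inj h i j j' hj hj').1 e))
    · intro r
      rcases inputs_cases h i r with ⟨t, rfl⟩ | ⟨j, hj, rfl⟩
      · exact ⟨Sum.inl t, rfl⟩
      · exact ⟨Sum.inr ⟨j, hj⟩, rfl⟩
  rw [← hb.sum_comp, Fintype.sum_sum_type]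
  rfl

lemma deriv_one (A : Alg.{u, v, w} P) (x : Fin 1 → A.carrier × A.carrier) :
    deriv (A.act 1 P.one) x = (x 0).2 := by
  simp [deriv_apply, A.act_one]

lemma deriv_perm (A : Alg.{u, v, w} P) {n : ℕ} (σ : Equiv.Perm (Fin n)) (μ : P.obj n)
    (x : Fin n → A.carrier × A.carrier) :
    deriv (A.act n (P.perm σ μ)) x = deriv (A.act n μ) (x ∘ σ.symm) := by
  simp only [deriv_apply, A.act_perm]
  refine Fintype.sum_equiv σ _ _ fun i => ?_
  congr 1
  funext j
  simp [Equiv.symm_apply_eq]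

lemma deriv_circ (A : Alg.{u, v, w} P) {m n k : ℕ} (h : k + 1 = m + n) (i : Fin m) (μ : P.obj m)
    (ν : P.obj n) (x : Fin k → A.carrier × A.carrier) :
    deriv (A.act k (P.circ h i μ ν)) x = deriv (A.act m μ)
      (plug h i (fun y => (A.act n ν fun t => (y t).1, deriv (A.act n ν) y)) x) := by
  rw [deriv_apply, deriv_apply, sum_inputs h i, Fintype.sum_eq_add_sum_subtype_ne _ i]
  congr 1
  · have key : ∀ a : A.carrier, (fun j => if j = i then a
        else (plug h i (fun y => (A.act n ν fun t => (y t).1, deriv (A.act n ν) y)) x j).1) =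
        Function.update (fun j => (plug h i (fun y => (A.act n ν fun t => (y t).1,
          deriv (A.act n ν) y)) x j).1) i a := by
      intro a
      funext j
      by_cases hj : j = i
      · subst hj; simp
      · simp [hj]
    have e : (fun j => if j = i
        then (plug h i (fun y => (A.act n ν fun t => (y t).1, deriv (A.act n ν) y)) x j).2
        else (plug h i (fun y => (A.act n ν fun t => (y t).1, deriv (A.act n ν) y)) x j).1) =
        fun j => if j = i then ∑ t, A.act n ν (fun t' => if t' = t then (x (inner h i t')).2
          else (x (inner h i t')).1) else
        (plug h i (fun y => (A.act n ν fun t => (y t).1, deriv (A.act n ν) y)) x j).1 := by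
      funext j
      by_cases hj : j = i
      · simp [hj, plug, deriv_apply]
      · simp [hj]
    rw [e, key, MultilinearMap.map_update_sum]
    refine Finset.sum_congr rfl fun t _ => ?_
    rw [A.act_circ, ← key]
    congr 1
    funext j
    by_cases hj : j = i
    · simp [hj, plug, inner_inj]
    · simp [hj, plug, (inner_ne_outer h i t j hj).symm]
  · refine Finset.sum_congr rfl fun j₀ _ => ?_
    rw [A.act_circ]
    congr 1
    funext j
    by_cases hj : j = i
    · subst hj
      simp [plug, inner_ne_outer, j₀.2.symm]
    · simp [hj, plug, outer_inj]

/-- The semi-direct product `A ⋉ A`, with the operations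
`μ((a₁, b₁), …, (aₙ, bₙ)) = (μ(a₁, …, aₙ), ∑ᵢ μ(a₁, …, bᵢ, …, aₙ))`. -/
abbrev semi (A : Alg.{u, v, w} P) : Alg.{u, v, w} P where
  carrier := A.carrier × A.carrier
  act n :=
    { toFun := fun μ => ((A.act n μ).compLinearMap fun _ => LinearMap.fst R _ _).prod
        (deriv (A.act n μ))
      map_add' := fun μ ν => by ext <;> simp [deriv_add]
      map_smul' := fun r μ => by ext <;> simp [deriv_smul] }
  act_one a := by simp [A.act_one, deriv_one]
  act_perm σ μ a := by simp [A.act_perm, deriv_perm, Function.comp_def]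
  act_circ h i μ ν a := by
    simp only [LinearMap.coe_mk, AddHom.coe_mk, MultilinearMap.prod_apply,
      MultilinearMap.compLinearMap_apply, A.act_circ, deriv_circ]
    refine Prod.ext ?_ rfl
    simp only
    congr 1
    funext j
    by_cases hj : j = i <;> simp [plug, hj]

/-- The semi-direct product `A ⋉ Aᵏ`, with the operations
`μ((a₁, b₁), …, (aₙ, bₙ)) = (μ(a₁, …, aₙ), (∑ᵢ μ(a₁, …, bᵢⱼ, …, aₙ))ⱼ)`. -/
abbrev semiPow (k : ℕ) (A : Alg.{u, v, w} P) : Alg.{u, v, w} P where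
  carrier := A.carrier × (Fin k → A.carrier)
  act n :=
    { toFun := fun μ => ((A.act n μ).compLinearMap fun _ => LinearMap.fst R _ _).prod
        (MultilinearMap.pi fun j => (deriv (A.act n μ)).compLinearMap fun _ =>
          (LinearMap.fst R _ _).prod (LinearMap.proj j ∘ₗ LinearMap.snd R _ _))
      map_add' := fun μ ν => by
        ext a
        · simp
        · simp [deriv_add]
      map_smul' := fun r μ => by
        ext a
        · simp
        · simp [deriv_smul] }
  act_one a := by
    refine Prod.ext ?_ (funext fun j => ?_)
    · simp [A.act_one]
    · simp [deriv_one]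
  act_perm σ μ a := by
    refine Prod.ext ?_ (funext fun j => ?_)
    · simp [A.act_perm, Function.comp_def]
    · simp [deriv_perm, Function.comp_def]
  act_circ h i μ ν a := by
    refine Prod.ext ?_ (funext fun r => ?_)
    · simp only [LinearMap.coe_mk, AddHom.coe_mk, MultilinearMap.prod_apply,
        MultilinearMap.compLinearMap_apply, A.act_circ]
      congr 1
      funext j
      by_cases hj : j = i <;> simp [plug, hj]
    · simp only [LinearMap.coe_mk, AddHom.coe_mk, MultilinearMap.prod_apply,
        MultilinearMap.pi_apply, MultilinearMap.compLinearMap_apply, deriv_circ]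
      congr 1
      funext j
      by_cases hj : j = i <;> simp [plug, hj]

lemma semi_act (A : Alg.{u, v, w} P) {n : ℕ} (μ : P.obj n) (x : Fin n → A.carrier × A.carrier) :
    (semi A).act n μ x = (A.act n μ (fun i => (x i).1), deriv (A.act n μ) x) := rfl

lemma semiPow_act (k : ℕ) (A : Alg.{u, v, w} P) {n : ℕ} (μ : P.obj n)
    (x : Fin n → A.carrier × (Fin k → A.carrier)) :
    (semiPow k A).act n μ x = (A.act n μ (fun i => (x i).1),
      fun j => deriv (A.act n μ) (fun i => ((x i).1, (x i).2 j))) := rfl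

lemma map_deriv {A B : Alg.{u, v, w} P} (f : A ⟶ B) {n : ℕ} (μ : P.obj n)
    (x : Fin n → A.carrier × A.carrier) :
    AlgHom.toLin f (deriv (A.act n μ) x) =
      deriv (B.act n μ) (fun i => (AlgHom.toLin f (x i).1, AlgHom.toLin f (x i).2)) := by
  simp only [deriv_apply, map_sum, AlgHom.map_act]
  refine Finset.sum_congr rfl fun i _ => ?_
  congr 1
  funext j
  split_ifs <;> rfl

/-! ### The tangent structure on the category of `P`-algebras -/

/-- The tangent bundle functor `A ↦ A ⋉ A`, `f ↦ f × f`. -/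
def semiFunctor (P : Operad.{u, v} R) : Alg.{u, v, w} P ⥤ Alg.{u, v, w} P where
  obj := semi
  map f := ⟨(AlgHom.toLin f).prodMap (AlgHom.toLin f), fun n μ a => Prod.ext
    (AlgHom.map_act f n μ _) (map_deriv f μ a)⟩

/-- The functor `A ↦ A ⋉ Aᵏ`. -/
def semiPowFunctor (P : Operad.{u, v} R) (k : ℕ) : Alg.{u, v, w} P ⥤ Alg.{u, v, w} P where
  obj := semiPow k
  map f := ⟨(AlgHom.toLin f).prodMap ((AlgHom.toLin f).compLeft (Fin k)),
    fun n μ a => Prod.ext (AlgHom.map_act f n μ _) (funext fun _ => map_deriv f μ _)⟩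

lemma deriv_eq {A : Type w} [AddCommGroup A] [Module R A] {n : ℕ}
    (f : MultilinearMap R (fun _ : Fin n => A) A) (a b : Fin n → A) :
    deriv f (fun i => (a i, b i)) = f.linearDeriv a b := by
  rw [deriv_apply, MultilinearMap.linearDeriv_apply]
  refine Finset.sum_congr rfl fun i _ => ?_
  congr 1
  funext j
  by_cases hj : j = i
  · subst hj; simp
  · simp [hj]

lemma deriv_deriv {A : Type w} [AddCommGroup A] [Module R A] {n : ℕ}
    (f : MultilinearMap R (fun _ : Fin n => A) A) (x : Fin n → (A × A) × (A × A)) :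
    (∑ i, deriv f fun j => if j = i then (x j).2 else (x j).1) =
      ∑ i, ∑ j, f fun r => if r = j then (if r = i then (x r).2.2 else (x r).1.2)
        else (if r = i then (x r).2.1 else (x r).1.1) := by
  simp only [deriv_apply]
  refine Finset.sum_congr rfl fun i _ => Finset.sum_congr rfl fun j _ => ?_
  congr 1
  funext r
  split_ifs <;> rfl

lemma deriv_semi (A : Alg.{u, v, w} P) {n : ℕ} (μ : P.obj n)
    (x : Fin n → (semi A).carrier × (semi A).carrier) :
    deriv ((semi A).act n μ) x =
      (deriv (A.act n μ) (fun i => ((x i).1.1, (x i).2.1)),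
        ∑ i, ∑ j, A.act n μ fun r => if r = j then (if r = i then (x r).2.2 else (x r).1.2)
          else (if r = i then (x r).2.1 else (x r).1.1)) := by
  rw [← deriv_deriv, deriv_apply, deriv_apply]
  refine Prod.ext ?_ ?_
  · rw [Prod.fst_sum]
    refine Finset.sum_congr rfl fun i _ => ?_
    rw [semi_act]
    simp only
    congr 1
    funext j
    split_ifs <;> rfl
  · rw [Prod.snd_sum]
    rfl

/-- The projection `A ⋉ A ⟶ A`. -/
def pHom (A : Alg.{u, v, w} P) : semi A ⟶ A := ⟨LinearMap.fst R _ _, fun _ _ _ => rfl⟩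

/-- The projection `A ⋉ Aᵏ ⟶ A`. -/
def πHom (k : ℕ) (A : Alg.{u, v, w} P) : semiPow k A ⟶ A :=
  ⟨LinearMap.fst R _ _, fun _ _ _ => rfl⟩

/-- The projection `A ⋉ Aᵏ ⟶ A ⋉ A`, `(a, b) ↦ (a, bⱼ)`. -/
def qHom (k : ℕ) (j : Fin k) (A : Alg.{u, v, w} P) : semiPow k A ⟶ semi A :=
  ⟨(LinearMap.fst R _ _).prod (LinearMap.proj j ∘ₗ LinearMap.snd R _ _), fun _ _ _ => rfl⟩

/-- The sum `A ⋉ A² ⟶ A ⋉ A`, `(a, b₁, b₂) ↦ (a, b₁ + b₂)`. -/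
def sHom (A : Alg.{u, v, w} P) : semiPow 2 A ⟶ semi A where
  toLin :=
    { toFun := fun x => (x.1, x.2 0 + x.2 1)
      map_add' := fun x y => Prod.ext rfl (add_add_add_comm _ _ _ _)
      map_smul' := fun r x => Prod.ext rfl (smul_add r _ _).symm }
  map_act n μ x := by
    refine Prod.ext rfl ?_
    change deriv (A.act n μ) (fun i => ((x i).1, (x i).2 0)) +
      deriv (A.act n μ) (fun i => ((x i).1, (x i).2 1)) =
      deriv (A.act n μ) (fun i => ((x i).1, (x i).2 0 + (x i).2 1))
    rw [deriv_eq, deriv_eq, deriv_eq, ← map_add]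
    rfl

/-- The zero map `A ⟶ A ⋉ A`, `a ↦ (a, 0)`. -/
def zHom (A : Alg.{u, v, w} P) : A ⟶ semi A :=
  ⟨LinearMap.inl R _ _, fun n μ x => by
    refine Prod.ext rfl ?_
    change 0 = deriv (A.act n μ) (fun i => (x i, 0))
    rw [deriv_eq]
    exact (map_zero _).symm⟩

/-- The negative map `A ⋉ A ⟶ A ⋉ A`, `(a, b) ↦ (a, -b)`. -/
def negHom (A : Alg.{u, v, w} P) : semi A ⟶ semi A :=
  ⟨(LinearMap.fst R _ _).prod (-LinearMap.snd R _ _), fun n μ x => by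
    refine Prod.ext rfl ?_
    change -deriv (A.act n μ) (fun i => ((x i).1, (x i).2)) =
      deriv (A.act n μ) (fun i => ((x i).1, -(x i).2))
    rw [deriv_eq, deriv_eq, ← map_neg]
    rfl⟩

/-- The vertical lift `A ⋉ A ⟶ (A ⋉ A) ⋉ (A ⋉ A)`, `(a, b) ↦ (a, 0, 0, b)`. -/
def lHom (A : Alg.{u, v, w} P) : semi A ⟶ semi (semi A) where
  toLin :=
    { toFun := fun x => ((x.1, 0), (0, x.2))
      map_add' := fun x y => Prod.ext (Prod.ext rfl (add_zero _).symm)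
        (Prod.ext (add_zero _).symm rfl)
      map_smul' := fun r x => Prod.ext (Prod.ext rfl (smul_zero _).symm)
        (Prod.ext (smul_zero _).symm rfl) }
  map_act n μ x := by
    refine Prod.ext (Prod.ext rfl ?_) ?_
    · change 0 = deriv (A.act n μ) (fun i => ((x i).1, 0))
      rw [deriv_eq]
      exact (map_zero _).symm
    · change (0, deriv (A.act n μ) x) = deriv ((semi A).act n μ)
        (fun i => (((x i).1, 0), (0, (x i).2)))
      rw [deriv_semi]
      refine Prod.ext ?_ ?_
      · simp only
        rw [deriv_eq]
        exact (map_zero _).symm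
      · simp only
        rw [deriv_apply]
        refine Finset.sum_congr rfl fun i _ => ?_
        rw [Finset.sum_eq_single i]
        · congr 1
          funext r
          split_ifs <;> rfl
        · intro j _ hj
          exact (A.act n μ).map_coord_zero j (by simp [hj])
        · simp

/-- The canonical flip on `(A ⋉ A) ⋉ (A ⋉ A)`, `(a, b, c, d) ↦ (a, c, b, d)`. -/
def cHom (A : Alg.{u, v, w} P) : semi (semi A) ⟶ semi (semi A) where
  toLin :=
    { toFun := fun x => ((x.1.1, x.2.1), (x.1.2, x.2.2))
      map_add' := fun x y => rfl
      map_smul' := fun r x => rfl }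
  map_act n μ x := by
    refine Prod.ext ?_ ?_
    · refine Prod.ext rfl ?_
      change (deriv ((semi A).act n μ) x).1 = _
      rw [deriv_semi]
      rfl
    · change (deriv (A.act n μ) (fun i => ((x i).1.1, (x i).1.2)),
          (deriv ((semi A).act n μ) x).2) =
        deriv ((semi A).act n μ)
          (fun i => (((x i).1.1, (x i).2.1), ((x i).1.2, (x i).2.2)))
      rw [deriv_semi, deriv_semi]
      refine Prod.ext rfl ?_
      simp only
      rw [Finset.sum_comm]
      refine Finset.sum_congr rfl fun i _ => Finset.sum_congr rfl fun j _ => ?_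
      congr 1
      funext r
      split_ifs <;> rfl

lemma exists_hom {X E : Alg.{u, v, w} P} (Q : X.carrier → E.carrier → Prop)
    (hQ : ∀ x, ∃! e, Q x e) (hadd : ∀ x y d e, Q x d → Q y e → Q (x + y) (d + e))
    (hsmul : ∀ (r : R) x e, Q x e → Q (r • x) (r • e))
    (hact : ∀ (n : ℕ) (μ : P.obj n) (x : Fin n → X.carrier) (e : Fin n → E.carrier),
      (∀ i, Q (x i) (e i)) → Q (X.act n μ x) (E.act n μ e)) :
    ∃ f : X ⟶ E, ∀ x, Q x (AlgHom.toLin f x) := by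
  choose f hf huniq using hQ
  exact ⟨⟨⟨⟨f, fun x y => (huniq _ _ (hadd _ _ _ _ (hf x) (hf y))).symm⟩,
    fun r x => (huniq _ _ (hsmul r _ _ (hf x))).symm⟩,
    fun n μ x => (huniq _ _ (hact n μ x _ fun i => hf (x i))).symm⟩, hf⟩

/-- The underlying sets form an `n`-fold pullback. -/
def SetNFold {A B E : Alg.{u, v, w} P} {n : ℕ} (p : B ⟶ A) (π : E ⟶ A)
    (q : Fin n → (E ⟶ B)) : Prop :=
  (∀ j e, AlgHom.toLin p (AlgHom.toLin (q j) e) = AlgHom.toLin π e) ∧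
    ∀ (a : A.carrier) (b : Fin n → B.carrier), (∀ j, AlgHom.toLin p (b j) = a) →
      ∃! e, AlgHom.toLin π e = a ∧ ∀ j, AlgHom.toLin (q j) e = b j

/-- The underlying sets form a pullback square. -/
def SetSquare {E B D A : Alg.{u, v, w} P} (f : E ⟶ B) (g : E ⟶ D) (h : B ⟶ A) (k : D ⟶ A) : Prop :=
  (∀ e, AlgHom.toLin h (AlgHom.toLin f e) = AlgHom.toLin k (AlgHom.toLin g e)) ∧
    ∀ b d, AlgHom.toLin h b = AlgHom.toLin k d →
      ∃! e, AlgHom.toLin f e = b ∧ AlgHom.toLin g e = d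

lemma SetNFold.isNFoldPullback {A B E : Alg.{u, v, w} P} {n : ℕ} {p : B ⟶ A} {π : E ⟶ A}
    {q : Fin n → (E ⟶ B)} (H : SetNFold p π q) : IsNFoldPullback p π q := by
  refine ⟨fun j => hom_ext' fun e => H.1 j e, fun X x g hg => ?_⟩
  have hg' : ∀ a, ∀ j, AlgHom.toLin p (AlgHom.toLin (g j) a) = AlgHom.toLin x a :=
    fun a j => by rw [← hg j]; rfl
  obtain ⟨f, hf⟩ := exists_hom (X := X) (E := E)
    (fun a e => AlgHom.toLin π e = AlgHom.toLin x a ∧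
      ∀ j, AlgHom.toLin (q j) e = AlgHom.toLin (g j) a)
    (fun a => H.2 _ _ (hg' a))
    (fun a b d e hd he => ⟨by simp [hd.1, he.1], fun j => by simp [hd.2, he.2]⟩)
    (fun r a e he => ⟨by simp [he.1], fun j => by simp [he.2]⟩)
    (fun n μ a e he => ⟨by simp [AlgHom.map_act, (he _).1],
      fun j => by simp [AlgHom.map_act, (he _).2]⟩)
  refine ⟨f, ⟨hom_ext' fun a => (hf a).1, fun j => hom_ext' fun a => (hf a).2 j⟩, ?_⟩
  rintro f' ⟨h₁, h₂⟩
  refine hom_ext' fun a => (H.2 _ _ (hg' a)).unique ⟨by rw [← h₁]; rfl, fun j => ?_⟩ (hf a)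
  rw [← h₂ j]; rfl

lemma SetNFold.map {A B E : Alg.{u, v, w} P} {n : ℕ} {p : B ⟶ A} {π : E ⟶ A}
    {q : Fin n → (E ⟶ B)} (H : SetNFold p π q) :
    SetNFold ((semiFunctor P).map p) ((semiFunctor P).map π)
      (fun j => (semiFunctor P).map (q j)) := by
  refine ⟨fun j e => Prod.ext (H.1 j e.1) (H.1 j e.2), fun a b hb => ?_⟩
  obtain ⟨e₁, he₁, hu₁⟩ := H.2 a.1 (fun j => (b j).1) fun j => congrArg Prod.fst (hb j)
  obtain ⟨e₂, he₂, hu₂⟩ := H.2 a.2 (fun j => (b j).2) fun j => congrArg Prod.snd (hb j)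
  refine ⟨(e₁, e₂), ⟨Prod.ext he₁.1 he₂.1, fun j => Prod.ext (he₁.2 j) (he₂.2 j)⟩, ?_⟩
  rintro ⟨d₁, d₂⟩ ⟨h₁, h₂⟩
  exact Prod.ext (hu₁ _ ⟨congrArg Prod.fst h₁, fun j => congrArg Prod.fst (h₂ j)⟩)
    (hu₂ _ ⟨congrArg Prod.snd h₁, fun j => congrArg Prod.snd (h₂ j)⟩)

lemma SetNFold.iter {A B E : Alg.{u, v, w} P} {n : ℕ} {p : B ⟶ A} {π : E ⟶ A}
    {q : Fin n → (E ⟶ B)} (H : SetNFold p π q) (m : ℕ) :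
    SetNFold ((iter (semiFunctor P) m).map p) ((iter (semiFunctor P) m).map π)
      (fun j => (iter (semiFunctor P) m).map (q j)) := by
  induction m with
  | zero => exact H
  | succ m ih => exact ih.map

lemma SetSquare.isPullback {E B D A : Alg.{u, v, w} P} {f : E ⟶ B} {g : E ⟶ D} {h : B ⟶ A}
    {k : D ⟶ A} (H : SetSquare f g h k) : IsPullback f g h k := by
  have w : f ≫ h = g ≫ k := hom_ext' H.1
  have key : ∀ s : Limits.PullbackCone h k, ∃ e : s.pt ⟶ E, ∀ a,
      AlgHom.toLin f (AlgHom.toLin e a) = AlgHom.toLin s.fst a ∧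
      AlgHom.toLin g (AlgHom.toLin e a) = AlgHom.toLin s.snd a := fun s =>
    exists_hom (X := s.pt) (E := E)
      (fun a e => AlgHom.toLin f e = AlgHom.toLin s.fst a ∧
        AlgHom.toLin g e = AlgHom.toLin s.snd a)
      (fun a => H.2 _ _ (by rw [← comp_toLin, s.condition]; rfl))
      (fun a b d e hd he => ⟨by simp [hd.1, he.1], by simp [hd.2, he.2]⟩)
      (fun r a e he => ⟨by simp [he.1], by simp [he.2]⟩)
      (fun n μ a e he => ⟨by simp [AlgHom.map_act, (he _).1], by simp [AlgHom.map_act, (he _).2]⟩)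
  choose e he using key
  refine ⟨⟨w⟩, ⟨Limits.PullbackCone.IsLimit.mk w e (fun s => hom_ext' fun a => (he s a).1)
    (fun s => hom_ext' fun a => (he s a).2) fun s d h₁ h₂ => hom_ext' fun a => ?_⟩⟩
  exact (H.2 _ _ (by rw [← comp_toLin, s.condition]; rfl)).unique
    ⟨by rw [← h₁]; rfl, by rw [← h₂]; rfl⟩ (he s a)

lemma SetSquare.map {E B D A : Alg.{u, v, w} P} {f : E ⟶ B} {g : E ⟶ D} {h : B ⟶ A}
    {k : D ⟶ A} (H : SetSquare f g h k) :
    SetSquare ((semiFunctor P).map f) ((semiFunctor P).map g) ((semiFunctor P).map h)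
      ((semiFunctor P).map k) := by
  refine ⟨fun e => Prod.ext (H.1 e.1) (H.1 e.2), fun b d hb => ?_⟩
  obtain ⟨e₁, he₁, hu₁⟩ := H.2 b.1 d.1 (congrArg Prod.fst hb)
  obtain ⟨e₂, he₂, hu₂⟩ := H.2 b.2 d.2 (congrArg Prod.snd hb)
  refine ⟨(e₁, e₂), ⟨Prod.ext he₁.1 he₂.1, Prod.ext he₁.2 he₂.2⟩, ?_⟩
  rintro ⟨d₁, d₂⟩ ⟨h₁, h₂⟩
  exact Prod.ext (hu₁ _ ⟨congrArg Prod.fst h₁, congrArg Prod.fst h₂⟩)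
    (hu₂ _ ⟨congrArg Prod.snd h₁, congrArg Prod.snd h₂⟩)

lemma SetSquare.iter {E B D A : Alg.{u, v, w} P} {f : E ⟶ B} {g : E ⟶ D} {h : B ⟶ A}
    {k : D ⟶ A} (H : SetSquare f g h k) (m : ℕ) :
    SetSquare ((iter (semiFunctor P) m).map f) ((iter (semiFunctor P) m).map g)
      ((iter (semiFunctor P) m).map h) ((iter (semiFunctor P) m).map k) := by
  induction m with
  | zero => exact H
  | succ m ih => exact ih.map

lemma setNFold_semiPow (n : ℕ) (A : Alg.{u, v, w} P) :
    SetNFold (pHom A) (πHom n A) (fun j => qHom n j A) := by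
  refine ⟨fun _ _ => rfl, fun a b hb => ⟨(a, fun j => (b j).2), ⟨rfl, fun j => ?_⟩, ?_⟩⟩
  · exact Prod.ext (hb j).symm rfl
  · rintro ⟨a', b'⟩ ⟨h₁, h₂⟩
    exact Prod.ext h₁ (funext fun j => congrArg Prod.snd (h₂ j))

lemma comp_sHom {X A : Alg.{u, v, w} P} {e : X ⟶ semiPow 2 A} {f g : X ⟶ semi A}
    (h₀ : e ≫ qHom 2 0 A = f) (h₁ : e ≫ qHom 2 1 A = g) (x : X.carrier) :
    AlgHom.toLin (e ≫ sHom A) x =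
      ((AlgHom.toLin f x).1, (AlgHom.toLin f x).2 + (AlgHom.toLin g x).2) := by
  subst h₀ h₁; rfl

lemma sHom_assoc {A : Alg.{u, v, w} P} {e₁₂ e₂₃ e e' : semiPow 3 A ⟶ semiPow 2 A}
    (h₁ : e₁₂ ≫ qHom 2 0 A = qHom 3 0 A) (h₂ : e₁₂ ≫ qHom 2 1 A = qHom 3 1 A)
    (h₃ : e₂₃ ≫ qHom 2 0 A = qHom 3 1 A) (h₄ : e₂₃ ≫ qHom 2 1 A = qHom 3 2 A)
    (h₅ : e ≫ qHom 2 0 A = e₁₂ ≫ sHom A) (h₆ : e ≫ qHom 2 1 A = qHom 3 2 A)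
    (h₇ : e' ≫ qHom 2 0 A = qHom 3 0 A) (h₈ : e' ≫ qHom 2 1 A = e₂₃ ≫ sHom A) :
    e ≫ sHom A = e' ≫ sHom A := by
  refine hom_ext' fun x => ?_
  rw [comp_sHom h₅ h₆, comp_sHom h₇ h₈, comp_sHom h₁ h₂, comp_sHom h₃ h₄]
  exact Prod.ext rfl (add_assoc _ _ _)

lemma comp_map_sHom {X A : Alg.{u, v, w} P} {e : X ⟶ semi (semiPow 2 A)}
    {f g : X ⟶ semi (semi A)} (h₀ : e ≫ (semiFunctor P).map (qHom 2 0 A) = f)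
    (h₁ : e ≫ (semiFunctor P).map (qHom 2 1 A) = g) (x : X.carrier) :
    AlgHom.toLin (e ≫ (semiFunctor P).map (sHom A)) x =
      (((AlgHom.toLin f x).1.1, (AlgHom.toLin f x).1.2 + (AlgHom.toLin g x).1.2),
        ((AlgHom.toLin f x).2.1, (AlgHom.toLin f x).2.2 + (AlgHom.toLin g x).2.2)) := by
  subst h₀ h₁; rfl

lemma lHom_sum {A : Alg.{u, v, w} P} {e : semiPow 2 A ⟶ semi (semiPow 2 A)}
    (h₀ : e ≫ (semiFunctor P).map (qHom 2 0 A) = qHom 2 0 A ≫ lHom A)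
    (h₁ : e ≫ (semiFunctor P).map (qHom 2 1 A) = qHom 2 1 A ≫ lHom A) :
    sHom A ≫ lHom A = e ≫ (semiFunctor P).map (sHom A) := by
  refine hom_ext' fun x => Eq.symm ((comp_map_sHom h₀ h₁ x).trans ?_)
  change ((x.1, (0 : A.carrier) + 0), ((0 : A.carrier), x.2 0 + x.2 1)) =
    ((x.1, (0 : A.carrier)), ((0 : A.carrier), x.2 0 + x.2 1))
  rw [add_zero]

lemma cHom_sum {A : Alg.{u, v, w} P} {e : semi (semiPow 2 A) ⟶ semiPow 2 (semi A)}
    (h₀ : e ≫ qHom 2 0 (semi A) = (semiFunctor P).map (qHom 2 0 A) ≫ cHom A)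
    (h₁ : e ≫ qHom 2 1 (semi A) = (semiFunctor P).map (qHom 2 1 A) ≫ cHom A) :
    (semiFunctor P).map (sHom A) ≫ cHom A = e ≫ sHom (semi A) := by
  refine hom_ext' fun x => Eq.symm ((comp_sHom h₀ h₁ x).trans ?_)
  change ((x.1.1, x.2.1), (x.1.2 0, x.2.2 0) + (x.1.2 1, x.2.2 1)) =
    ((x.1.1, x.2.1), (x.1.2 0 + x.1.2 1, x.2.2 0 + x.2.2 1))
  rfl

lemma setSquare_lift {A : Alg.{u, v, w} P} {e : semiPow 2 A ⟶ semi (semiPow 2 A)}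
    (h₀ : e ≫ (semiFunctor P).map (qHom 2 0 A) = qHom 2 0 A ≫ lHom A)
    (h₁ : e ≫ (semiFunctor P).map (qHom 2 1 A) = qHom 2 1 A ≫ zHom (semi A)) :
    SetSquare (e ≫ (semiFunctor P).map (sHom A)) (πHom 2 A) ((semiFunctor P).map (pHom A))
      (zHom A) := by
  have key : ∀ x, AlgHom.toLin (e ≫ (semiFunctor P).map (sHom A)) x =
      ((x.1, x.2 1), ((0 : A.carrier), x.2 0)) := fun x =>
    (comp_map_sHom h₀ h₁ x).trans
      (Prod.ext (Prod.ext rfl (zero_add _)) (Prod.ext rfl (add_zero _)))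
  refine ⟨fun x => by rw [key]; rfl, fun b d hbd => ?_⟩
  have hb₁ : b.1.1 = d := congrArg Prod.fst hbd
  have hb₂ : b.2.1 = 0 := congrArg Prod.snd hbd
  refine ⟨(d, ![b.2.2, b.1.2]), ⟨?_, rfl⟩, ?_⟩
  · rw [key]
    exact Prod.ext (Prod.ext hb₁.symm rfl) (Prod.ext hb₂.symm rfl)
  · rintro ⟨a, y⟩ ⟨ha, hd⟩
    rw [key] at ha
    refine Prod.ext hd (funext fun j => ?_)
    fin_cases j
    · exact congrArg (fun t => t.2.2) ha
    · exact congrArg (fun t => t.1.2) ha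

lemma isIso_of_bijective {A B : Alg.{u, v, w} P} (f : A ⟶ B)
    (hf : Function.Bijective (AlgHom.toLin f)) : IsIso f := by
  let e := LinearEquiv.ofBijective (AlgHom.toLin f) hf
  refine ⟨⟨e.symm.toLinearMap, fun n μ b => ?_⟩, hom_ext' fun a => e.symm_apply_apply a,
    hom_ext' fun b => e.apply_symm_apply b⟩
  apply e.injective
  rw [LinearEquiv.coe_coe, e.apply_symm_apply]
  refine Eq.trans ?_ (AlgHom.map_act f n μ _).symm
  congr 1
  funext i
  exact (e.apply_symm_apply (b i)).symm

variable (P) in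
/-- The Cartesian Rosický tangent structure on the category of `P`-algebras whose tangent bundle
functor is `A ↦ A ⋉ A`. -/
def tangent : CartesianRosickyTangentStructure (Alg.{u, v, w} P) where
  T := semiFunctor P
  p := { app := pHom }
  Tn := semiPowFunctor P
  π k := { app := πHom k }
  q k j := { app := qHom k j }
  isPullback m n A := ((setNFold_semiPow n A).iter m).isNFoldPullback
  s := { app := sHom
         naturality := fun A B f => hom_ext' fun x =>
           Prod.ext rfl (map_add (AlgHom.toLin f) (x.2 0) (x.2 1)).symm }
  z := { app := zHom
         naturality := fun A B f => hom_ext' fun x =>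
           Prod.ext rfl (map_zero (AlgHom.toLin f)).symm }
  l := { app := lHom
         naturality := fun A B f => hom_ext' fun x => Prod.ext
           (Prod.ext rfl (map_zero (AlgHom.toLin f)).symm)
           (Prod.ext (map_zero (AlgHom.toLin f)).symm rfl) }
  c := { app := cHom
         naturality := fun A B f => hom_ext' fun x =>
           Prod.ext (Prod.ext rfl rfl) (Prod.ext rfl rfl) }
  s_p A := rfl
  z_p A := rfl
  s_zero A e h₀ h₁ := hom_ext' fun x => (comp_sHom h₀ h₁ x).trans (Prod.ext rfl (add_zero _))
  s_comm A e h₀ h₁ := hom_ext' fun x => (comp_sHom h₀ h₁ x).trans (Prod.ext rfl (add_comm _ _))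
  s_assoc A e₁₂ e₂₃ e e' h₁ h₂ h₃ h₄ h₅ h₆ h₇ h₈ := sHom_assoc h₁ h₂ h₃ h₄ h₅ h₆ h₇ h₈
  l_p A := hom_ext' fun x => rfl
  l_z A := hom_ext' fun x => rfl
  l_s A e h₀ h₁ := lHom_sum h₀ h₁
  c_p A := hom_ext' fun x => rfl
  c_z A := hom_ext' fun x => rfl
  c_s A e h₀ h₁ := cHom_sum h₀ h₁
  c_c A := hom_ext' fun x => rfl
  l_c A := hom_ext' fun x => rfl
  l_l A := hom_ext' fun x => rfl
  c_braid A := hom_ext' fun x => rfl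
  l_c_c A := hom_ext' fun x => rfl
  universal m A e h₀ h₁ := ((setSquare_lift h₀ h₁).iter m).isPullback
  isIso_prod A B := isIso_of_bijective _ ⟨by
      rintro ⟨⟨a, b⟩, ⟨c, d⟩⟩ ⟨⟨a', b'⟩, ⟨c', d'⟩⟩ h
      have h₁ : (a, c) = (a', c') := congrArg Prod.fst h
      have h₂ : (b, d) = (b', d') := congrArg Prod.snd h
      obtain ⟨rfl, rfl⟩ := Prod.mk.inj h₁
      obtain ⟨rfl, rfl⟩ := Prod.mk.inj h₂
      rfl,
    fun y => ⟨((y.1.1, y.2.1), (y.1.2, y.2.2)), rfl⟩⟩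
  isIso_terminal := isIso_of_bijective _
    ⟨fun x y _ => @Subsingleton.elim (PUnit × PUnit) _ x y,
      fun _ => ⟨(PUnit.unit, PUnit.unit), rfl⟩⟩
  neg := { app := negHom
           naturality := fun A B f => hom_ext' fun x =>
             Prod.ext rfl (map_neg (AlgHom.toLin f) x.2).symm }
  neg_p A := hom_ext' fun x => rfl
  neg_s A e h₀ h₁ := hom_ext' fun x =>
    (comp_sHom h₀ h₁ x).trans (Prod.ext rfl (add_neg_cancel _))

end

end OperadTangent

/-! Morphisms of `P`-algebras are `R`-linear, and this forces the data of a differential object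
structure. The zero `ζ` starts at the zero module, so it is `0`; a linear map `σ` that is unital for
`0` is `(a, b) ↦ a + b` (`toLin_σ`). From `phat_z`, `p̂(a, 0) = 0`, so `p̂(a, b) = g(b)` with `g(b)
= p̂(0, b)`. Compatibility with the vertical lift says `g ∘ g = g`, and invertibility of `⟨p, p̂⟩`
makes `g` injective, so `g` is the identity and `p̂` is the second projection (`toLin_phat`). This
gives uniqueness.

The obstruction to existence is that `p̂` must respect the operations. On the inputs `(0, aᵢ)` of `A
⋉ A` this reads `μ(a₁, …, aₙ) = ∑ᵢ μ(0, …, aᵢ, …, 0)`, and for `n ≠ 1` the right-hand side vanishes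
(`deriv_zero_left`). Hence every operation of arity other than `1` is zero (`act_eq_zero`).

Conversely, unary operations are linear maps, with which the second projection, the addition and the
zero all commute. If the other operations vanish, these three maps are therefore morphisms, and the
axioms reduce to those of the additive group of `A`. -/

namespace OperadTangent

open CategoryTheory CategoryTheory.MonoidalCategory CategoryTheory.CartesianMonoidalCategory

universe u v w

section DifferentialObjects

variable {R : Type u} [CommRing R] {P : Operad.{u, v} R} {A : Alg.{u, v, w} P}

/-- Each summand keeps one `b i` and has `0` in all other slots. For `n ≥ 2` there is such a slot,
and multilinearity kills the summand; for `n = 0` the sum is empty. This is where arity `1` is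
singled out. -/
lemma deriv_zero_left {M : Type w} [AddCommGroup M] [Module R M] {n : ℕ}
    (hn : n ≠ 1) (f : MultilinearMap R (fun _ : Fin n => M) M)
    (b : Fin n → M) : deriv f (fun i => (0, b i)) = 0 := by
  rw [deriv_apply]
  refine Finset.sum_eq_zero fun i _ => ?_
  have : ∃ j : Fin n, j ≠ i := by
    -- The summation index `i` itself rules out `n = 0`, so `n ≠ 1` leaves `2 ≤ n`.
    have hi := i.isLt
    have : Nontrivial (Fin n) := Fin.nontrivial_iff_two_le.2 (by omega)
    exact exists_ne i
  obtain ⟨j, hj⟩ := this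
  exact f.map_coord_zero j (by simp [hj])

/-! ### Uniqueness, and the vanishing of the non-unary operations. -/

namespace DifferentialStructure

variable (D : DifferentialStructure (tangent P).toCartesianTangentStructure A)

/-- The zero of a differential object structure is zero. -/
lemma toLin_ζ (x : PUnit) : AlgHom.toLin D.ζ x = 0 :=
  map_zero (AlgHom.toLin D.ζ)

/-- By unitality and linearity, the sum of a differential object structure is the addition. -/
lemma toLin_σ (x : A.carrier × A.carrier) : AlgHom.toLin D.σ x = x.1 + x.2 := by
  -- The two unit laws, evaluated at the components of `x`; they determine `σ` on each summand of `A
  -- × A`.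
  have h₁ : AlgHom.toLin D.σ (x.1, AlgHom.toLin D.ζ PUnit.unit) = x.1 :=
    congrArg (fun f => AlgHom.toLin f x.1) D.add_zero
  have h₂ : AlgHom.toLin D.σ (AlgHom.toLin D.ζ PUnit.unit, x.2) = x.2 :=
    congrArg (fun f => AlgHom.toLin f x.2) D.zero_add
  rw [toLin_ζ] at h₁ h₂
  have h : AlgHom.toLin D.σ ((x.1, 0) + (0, x.2)) =
      AlgHom.toLin D.σ (x.1, 0) + AlgHom.toLin D.σ (0, x.2) :=
    map_add (AlgHom.toLin D.σ) _ _
  rw [h₁, h₂] at h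
  rw [← h, Prod.mk_add_mk, _root_.add_zero, _root_.zero_add]

lemma toLin_phat_inl (a : A.carrier) : AlgHom.toLin D.phat (a, (0 : A.carrier)) = 0 :=
  (congrArg (fun f => AlgHom.toLin f a) D.phat_z).trans (toLin_ζ D _)

/-- By linearity, `p̂(a, b) = p̂(a, 0) + p̂(0, b)`, and the first term vanishes. Thus `p̂` is
determined by its restriction to the fibre over `0`. -/
lemma toLin_phat_eq (x : A.carrier × A.carrier) :
    AlgHom.toLin D.phat x = AlgHom.toLin D.phat ((0 : A.carrier), x.2) := by
  have h : AlgHom.toLin D.phat ((x.1, 0) + (0, x.2)) =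
      AlgHom.toLin D.phat (x.1, (0 : A.carrier)) + AlgHom.toLin D.phat ((0 : A.carrier), x.2) :=
    map_add (AlgHom.toLin D.phat) _ _
  rw [toLin_phat_inl, _root_.zero_add] at h
  refine Eq.trans (congrArg (AlgHom.toLin D.phat) ?_) h
  exact Prod.ext (_root_.add_zero x.1).symm (_root_.zero_add x.2).symm

/-- The differential projection is an idempotent on the second component, and it is injective
there, so it is the second projection. -/
lemma toLin_phat (x : A.carrier × A.carrier) : AlgHom.toLin D.phat x = x.2 := by
  -- The lift sends `x` to `((x.1, 0), (0, x.2))` and `T(p̂)` applies `p̂` to each of the two pairs.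
  -- After the rewriting below, this is the idempotency `p̂(0, p̂ x) = p̂ x`.
  have hl : AlgHom.toLin D.phat (AlgHom.toLin D.phat (x.1, (0 : A.carrier)),
      AlgHom.toLin D.phat ((0 : A.carrier), x.2)) = AlgHom.toLin D.phat x :=
    congrArg (fun f => AlgHom.toLin f x) D.phat_lift
  rw [toLin_phat_inl, ← toLin_phat_eq D x] at hl
  -- A categorical inverse is in particular a left inverse on elements.
  have hinj : Function.Injective (AlgHom.toLin (lift (pHom A) D.phat)) := by
    have : IsIso (lift (pHom A) D.phat) := D.isIso_lift
    refine Function.LeftInverse.injective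
      (g := AlgHom.toLin (inv (lift (pHom A) D.phat))) fun y => ?_
    rw [← comp_toLin, IsIso.hom_inv_id, id_toLin]
  -- Both pairs lie over `0`, and `p̂` takes the value `p̂ x` on each: on the left by idempotency,
  -- on the right because `p̂` ignores the first component.
  have he : ((0 : A.carrier), AlgHom.toLin D.phat x) = (0, x.2) :=
    hinj (Prod.ext rfl (hl.trans (toLin_phat_eq D x)))
  exact congrArg Prod.snd he

/-- An algebra that carries a differential object structure has only unary operations. -/
lemma act_eq_zero
    (D : DifferentialStructure (tangent P).toCartesianTangentStructure A) {n : ℕ} (hn : n ≠ 1) (μ : P.obj n) (a : Fin n → A.carrier) :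
    A.act n μ a = 0 := by
  -- Base point `0` is the choice that makes the derivative side vanish while the other side remains
  -- `μ(a₁, …, aₙ)`.
  have h := AlgHom.map_act D.phat n μ (fun i => ((0 : A.carrier), a i))
  have h' : deriv (A.act n μ) (fun i => (0, a i)) =
      A.act n μ fun i => AlgHom.toLin D.phat ((0 : A.carrier), a i) :=
    (toLin_phat D _).symm.trans h
  simp only [toLin_phat] at h'
  rw [← h', deriv_zero_left hn]

variable (A) in
lemma subsingleton :
    Subsingleton (DifferentialStructure (tangent P).toCartesianTangentStructure A) := by
  refine ⟨fun D E => ?_⟩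
  have h₁ : D.phat = E.phat := hom_ext' fun x => (toLin_phat D x).trans (toLin_phat E x).symm
  have h₂ : D.σ = E.σ := hom_ext' fun x => (toLin_σ D x).trans (toLin_σ E x).symm
  have h₃ : D.ζ = E.ζ := hom_ext' fun x => (toLin_ζ D x).trans (toLin_ζ E x).symm
  -- All remaining fields are propositions, so equality of the three maps suffices.
  cases D
  cases E
  simp only at h₁ h₂ h₃
  subst h₁ h₂ h₃
  rfl

end DifferentialStructure

/-! ### Existence when only unary operations are nonzero. -/

/-- The second projection `A ⋉ A ⟶ A`, for an algebra with only unary operations. -/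
def sndSemiHom (H : ∀ n : ℕ, n ≠ 1 → ∀ (μ : P.obj n) (a : Fin n → A.carrier), A.act n μ a = 0) :
    semi A ⟶ A :=
  ⟨LinearMap.snd R _ _, fun n μ x => by
    change deriv (A.act n μ) x = A.act n μ fun i => (x i).2
    rw [deriv_apply]
    by_cases hn : n = 1
    · subst hn
      -- In arity `1` the derivative has a single summand, with the tangent component in the only
      -- slot.
      rw [Fin.sum_univ_one]
      congr 1
      funext j
      rw [if_pos (Subsingleton.elim _ _)]
    -- Here both sides are zero, the left one term by term.
    · simp only [H n hn, Finset.sum_const_zero]⟩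

/-- The addition `A × A ⟶ A`, for an algebra with only unary operations. -/
def addHom (H : ∀ n : ℕ, n ≠ 1 → ∀ (μ : P.obj n) (a : Fin n → A.carrier), A.act n μ a = 0) :
    prodAlg A A ⟶ A :=
  ⟨LinearMap.fst R _ _ + LinearMap.snd R _ _, fun n μ x => by
    change A.act n μ (fun i => (x i).1) + A.act n μ (fun i => (x i).2) =
      A.act n μ fun i => (x i).1 + (x i).2
    by_cases hn : n = 1
    · subst hn
      -- A vector indexed by `Fin 1` is an update of the zero vector at its only index; in this form
      -- additivity in one variable is additivity of the unary operation.
      have key : ∀ y : Fin 1 → A.carrier, y = Function.update (fun _ => 0) 0 (y 0) := fun y =>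
        funext fun j => by rw [Subsingleton.elim j 0, Function.update_self]
      rw [key fun i => (x i).1, key fun i => (x i).2, key fun i => (x i).1 + (x i).2,
        MultilinearMap.map_update_add]
    · simp only [H n hn, _root_.add_zero]⟩

/-- The differential object structure on an algebra with only unary operations. -/
def differentialStructure
    (H : ∀ n : ℕ, n ≠ 1 → ∀ (μ : P.obj n) (a : Fin n → A.carrier), A.act n μ a = 0) :
    DifferentialStructure (tangent P).toCartesianTangentStructure A where
  phat := sndSemiHom H
  σ := addHom H
  ζ := ⟨0, fun n μ a => by
    -- The point `0` must be fixed by every operation: a unary one fixes it by linearity, and any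
    -- other one, constants included, is zero by `H`.
    by_cases hn : n = 1
    · subst hn
      exact ((A.act 1 μ).map_coord_zero 0 rfl).symm
    · exact (H n hn μ _).symm⟩
  zero_add := hom_ext' fun x => _root_.zero_add x
  add_zero := hom_ext' fun x => _root_.add_zero x
  add_comm := hom_ext' fun x => _root_.add_comm x.2 x.1
  add_assoc := hom_ext' fun x => _root_.add_assoc x.1.1 x.1.2 x.2
  -- On elements `⟨p, p̂⟩` is the identity of `A × A`, though the operations on the source and
  -- target are defined differently.
  isIso_lift := isIso_of_bijective _ Function.bijective_id
  phat_s := hom_ext' fun _ => rfl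
  phat_z := hom_ext' fun _ => rfl
  phat_sum := hom_ext' fun _ => rfl
  phat_zero := hom_ext' fun _ => rfl
  phat_lift := hom_ext' fun _ => rfl

end DifferentialObjects

end OperadTangent

theorem mainTheorem9 {R : Type*} [CommRing R] (P : OperadTangent.Operad R)
    (A : OperadTangent.Alg P) :
    Subsingleton (OperadTangent.DifferentialStructure
        (OperadTangent.tangent P).toCartesianTangentStructure A) ∧
      (Nonempty (OperadTangent.DifferentialStructure
          (OperadTangent.tangent P).toCartesianTangentStructure A) ↔
        ∀ n : ℕ, n ≠ 1 → ∀ (μ : P.obj n) (a : Fin n → A.carrier), A.act n μ a = 0) :=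
  ⟨OperadTangent.DifferentialStructure.subsingleton A,
    fun ⟨D⟩ _ hn μ a => D.act_eq_zero hn μ a,
    fun H => ⟨OperadTangent.differentialStructure H⟩⟩
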